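/- A normal contact algebra $(A,C)$ is a Boolean algebra $A$ (with bottom $0$, top $1$ and complement ${}^*$; the case $0=1$ is allowed) with a binary relation $C$ on $A$ such that, for all $a,b,c\in A$: (C1) if $a\neq 0$ then $aCa$; (C2) if $aCb$ then $a\neq 0$ and $b\neq 0$; (C3) $aCb$ implies $bCa$; (C4) $aC(b\vee c)$ iff $aCb$ or $aCc$; (C5) if not $aCb$, then there is $c\in A$ such that neither $aCc$ nor $bCc^*$ holds; (C6) if $a\neq 1$, then there is $b\neq 0$ such that not $bCa$. It is complete if the Boolean algebra $A$ is complete. Let $\mathbf{ESkeC}$ be the category whose objects are all complete normal contact algebras and whose morphisms $\psi:(A,C)\to(B,C')$ are all functions $\psi:A\to B$ such that: (EF1) for every $a\in A$, $\psi(a)=0$ iff $a=0$; (EF2) $\psi$ preserves all joins; (EF3) if $a\in A$, $b\in B$ and $b\le\psi(a)$, then there is $c\in A$ with $c\le a$ and $\psi(c)=b$; (EF4) for all $a,b\in A$, $aCb$ implies $\psi(a)C'\psi(b)$. Composition is composition of functions. Let $\mathbf{EOpC}$ be the category with the same objects as $\mathbf{ESkeC}$, whose morphisms are all $\mathbf{ESkeC}$-morphisms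 $\psi:(A,C)\to(B,C')$ such that: (EC7) for all $a\in A$ and $b\in B$, $\psi(a)\,C'\,b$ implies $a\,C\,\psi_P(b)$, where $\psi_P:B\to A$ is the right adjoint of $\psi$, i.e. $\psi(a)\le b$ iff $a\le\psi_P(b)$; explicitly $\psi_P(b)=\bigvee\{a\in A : \psi(a)\le b\}$. Let $\mathbf{OpC}$ be the category of all compact Hausdorff spaces and all continuous open (not necessarily surjective) maps between them. Theorem 4.9. The categories $\mathbf{OpC}$ and $\mathbf{EOpC}$ are equivalent. -/

import Mathlib

open CategoryTheory

universe u

namespace ContactDuality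

/-- A *normal contact relation* on a Boolean algebra `B`: the axioms (C1)-(C4) of a contact
algebra together with the normality axioms (C5) and (C6). The one-element Boolean algebra
(`⊥ = ⊤`) is allowed. -/
structure IsNormalContact {B : Type u} [BooleanAlgebra B] (C : B → B → Prop) : Prop where
  /-- (C1) -/
  self_of_ne_bot : ∀ a : B, a ≠ ⊥ → C a a
  /-- (C2) -/
  ne_bot : ∀ a b : B, C a b → a ≠ ⊥ ∧ b ≠ ⊥
  /-- (C3) -/
  symm : ∀ a b : B, C a b → C b a
  /-- (C4) -/
  sup_iff : ∀ a b c : B, C a (b ⊔ c) ↔ C a b ∨ C a c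
  /-- (C5) -/
  interpolate : ∀ a b : B, ¬ C a b → ∃ c : B, ¬ C a c ∧ ¬ C b cᶜ
  /-- (C6) -/
  exists_far : ∀ a : B, a ≠ ⊤ → ∃ b : B, b ≠ ⊥ ∧ ¬ C b a

/-- The right adjoint `ψ_P` of a join-preserving map `ψ : A → B` between complete lattices,
given by `ψ_P b = ⋁ {a | ψ a ≤ b}`; see `gc_rightAdj`. -/
def rightAdj {A B : Type u} [CompleteLattice A] [CompleteLattice B] (ψ : A → B) (b : B) : A :=
  sSup {a : A | ψ a ≤ b}

theorem gc_rightAdj {A B : Type u} [CompleteLattice A] [CompleteLattice B] (ψ : A → B)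
    (h : ∀ S : Set A, ψ (sSup S) = sSup (ψ '' S)) : GaloisConnection ψ (rightAdj ψ) := by
  have hmono : Monotone ψ := by
    intro a a' haa'
    have h2 := h {a, a'}
    rw [sSup_pair, sup_eq_right.mpr haa', Set.image_pair, sSup_pair] at h2
    rw [h2]
    exact le_sup_left
  intro a b
  constructor
  · intro hab
    exact le_sSup hab
  · intro hab
    refine (hmono hab).trans ?_
    unfold rightAdj
    rw [h]
    refine sSup_le ?_
    rintro _ ⟨x, hx, rfl⟩
    exact hx

/-- An object of the category `ESkeC`: a complete normal contact algebra. -/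
structure ESkeC : Type (u + 1) where
  /-- the underlying set -/
  carrier : Type u
  /-- the complete Boolean algebra structure -/
  [cba : CompleteBooleanAlgebra carrier]
  /-- the contact relation -/
  C : carrier → carrier → Prop
  isNormalContact : IsNormalContact C

attribute [instance] ESkeC.cba

/-- A morphism of the category `ESkeC`: a function satisfying (EF1)-(EF4). -/
@[ext]
structure ESkeHom (A B : ESkeC.{u}) : Type u where
  /-- the underlying function -/
  toFun : A.carrier → B.carrier
  /-- (EF1) -/
  eq_bot_iff : ∀ a : A.carrier, toFun a = ⊥ ↔ a = ⊥
  /-- (EF2) all joins are preserved -/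
  map_sSup : ∀ S : Set A.carrier, toFun (sSup S) = sSup (toFun '' S)
  /-- (EF3) -/
  exists_preimage : ∀ (a : A.carrier) (b : B.carrier), b ≤ toFun a →
    ∃ c : A.carrier, c ≤ a ∧ toFun c = b
  /-- (EF4) -/
  map_contact : ∀ a b : A.carrier, A.C a b → B.C (toFun a) (toFun b)

/-- The category `ESkeC`, with composition of functions and identity functions. -/
instance : Category ESkeC.{u} where
  Hom A B := ESkeHom A B
  id A :=
    { toFun := fun a => a
      eq_bot_iff := fun _ => Iff.rfl
      map_sSup := fun S => by rw [Set.image_id']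
      exists_preimage := fun _ b hb => ⟨b, hb, rfl⟩
      map_contact := fun _ _ h => h }
  comp {A B D} f g :=
    { toFun := fun a => g.toFun (f.toFun a)
      eq_bot_iff := fun a => (g.eq_bot_iff _).trans (f.eq_bot_iff a)
      map_sSup := fun S => by rw [f.map_sSup, g.map_sSup, Set.image_image]
      exists_preimage := fun a b hb => by
        obtain ⟨c, hc, rfl⟩ := g.exists_preimage _ b hb
        obtain ⟨d, hd, rfl⟩ := f.exists_preimage a c hc
        exact ⟨d, hd, rfl⟩
      map_contact := fun a b h => g.map_contact _ _ (f.map_contact a b h) }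

/-- Condition (EC7): if `ψ(a) C' b` then `a C ψ_P(b)`. -/
def condEC7 : MorphismProperty ESkeC.{u} := fun A B ψ =>
  ∀ (a : A.carrier) (b : B.carrier), B.C (ESkeHom.toFun ψ a) b →
    A.C a (rightAdj (ESkeHom.toFun ψ) b)

instance : (condEC7.{u}).IsMultiplicative where
  id_mem A := by
    intro a b h
    have hb : rightAdj (ESkeHom.toFun (𝟙 A)) b = b :=
      le_antisymm (sSup_le fun x hx => hx) (le_sSup (le_refl b))
    rw [hb]
    exact h
  comp_mem {A B D} f g hf hg := by
    intro a d h
    have h1 := hf a _ (hg _ d h)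
    have gcf := gc_rightAdj (ESkeHom.toFun f) (ESkeHom.map_sSup f)
    have gcg := gc_rightAdj (ESkeHom.toFun g) (ESkeHom.map_sSup g)
    have h2 : rightAdj (ESkeHom.toFun (f ≫ g)) d =
        rightAdj (ESkeHom.toFun f) (rightAdj (ESkeHom.toFun g) d) := by
      refine le_antisymm (sSup_le fun x hx => ?_) (le_sSup ?_)
      · exact (gcf.compose gcg).le_u hx
      · exact (gcf.compose gcg).l_u_le d
    rw [h2]
    exact h1

/-- The category `EOpC`: all complete normal contact algebras, and all `ESkeC`-morphisms
satisfying (EC7). -/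
abbrev EOpC : Type (u + 1) := WideSubcategory condEC7.{u}

/-- Openness, as a property of continuous maps between compact Hausdorff spaces. -/
def openMaps : MorphismProperty CompHaus.{u} := fun _ _ f => IsOpenMap f

instance : (openMaps.{u}).IsMultiplicative where
  id_mem _ := IsOpenMap.id
  comp_mem f g (hf : IsOpenMap f) (hg : IsOpenMap g) := hg.comp hf

/-- The category `OpC`: all compact Hausdorff spaces, and all continuous open maps (not
necessarily surjective). -/
abbrev OpC : Type (u + 1) := WideSubcategory openMaps.{u}

end ContactDuality

/-! The equivalence sends a compact Hausdorff space to its algebra of regular closed sets, with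
contact meaning intersection, and an open map `f` to its direct image. The right adjoint of direct
image is preimage, so (EC7) says that if `f(F)` meets `G`, then `F` meets the preimage of `G`.

Faithfulness holds because regular closed neighbourhoods separate points. For fullness
(`exists_continuous_isOpenMap_image_eq`), a morphism `ψ` determines `f x` as the only point common
to all `ψ F`, `F` a regular closed neighbourhood of `x`. Compactness gives existence; (EF4) and
(EC7) give uniqueness.

For essential surjectivity, the points of the dual space are clusters: the elements in contact with
every member of some ultrafilter, here the complement of a prime ideal. The loci `{σ | a ∈ σ}`
generate the closed sets. Axiom (C5) yields the Hausdorff property, ultralimits of prime ideals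
yield compactness, (C6) makes `a ↦ locus C a` an order embedding, and completeness of the algebra
makes it onto the regular closed sets. -/

namespace ContactDuality

/-! ### The contact algebra of regular closed sets. -/

open Set Topology

/-- The regular closed subsets of a topological space. -/
structure RegularClosed (X : Type*) [TopologicalSpace X] where
  carrier : Set X
  closure_interior' : closure (interior carrier) = carrier

namespace RegularClosed

section Order

variable {X : Type*} [TopologicalSpace X]

instance : SetLike (RegularClosed X) X where
  coe := carrier
  coe_injective := by
    rintro ⟨s, hs⟩ ⟨t, ht⟩ h
    cases h
    rfl

instance : PartialOrder (RegularClosed X) := .ofSetLike (RegularClosed X) X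

theorem closure_interior (F : RegularClosed X) : closure (interior (F : Set X)) = F :=
  F.closure_interior'

theorem isClosed (F : RegularClosed X) : IsClosed (F : Set X) := by
  rw [← F.closure_interior]
  exact isClosed_closure

theorem coe_le_coe {F G : RegularClosed X} : (F : Set X) ⊆ G ↔ F ≤ G := Iff.rfl

/-- The closure of an open set, as a regular closed set. -/
def ofOpen (U : Set X) (hU : IsOpen U) : RegularClosed X where
  carrier := closure U
  closure_interior' :=
    (closure_minimal interior_subset isClosed_closure).antisymm
      (closure_mono (interior_maximal subset_closure hU))

theorem coe_ofOpen (U : Set X) (hU : IsOpen U) : (ofOpen U hU : Set X) = closure U := rfl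

theorem ofOpen_le_iff {U : Set X} {hU : IsOpen U} {F : RegularClosed X} :
    ofOpen U hU ≤ F ↔ U ⊆ F := by
  rw [← coe_le_coe, coe_ofOpen, F.isClosed.closure_subset_iff]

theorem le_ofOpen {U : Set X} {hU : IsOpen U} {F : RegularClosed X}
    (h : interior (F : Set X) ⊆ U) : F ≤ ofOpen U hU := by
  rw [← coe_le_coe, coe_ofOpen, ← F.closure_interior]
  exact closure_mono h

theorem coe_union_closure_interior (F G : RegularClosed X) :
    closure (interior ((F : Set X) ∪ G)) = (F : Set X) ∪ G := by
  refine (closure_minimal interior_subset (F.isClosed.union G.isClosed)).antisymm ?_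
  conv_lhs => rw [← F.closure_interior, ← G.closure_interior, ← closure_union]
  exact closure_mono (union_subset (interior_mono subset_union_left)
    (interior_mono subset_union_right))

instance : Max (RegularClosed X) := ⟨fun F G => ⟨(F : Set X) ∪ G, coe_union_closure_interior F G⟩⟩

instance : Min (RegularClosed X) := ⟨fun F G => ofOpen (interior ((F : Set X) ∩ G)) isOpen_interior⟩

instance : Compl (RegularClosed X) := ⟨fun F => ofOpen (F : Set X)ᶜ F.isClosed.isOpen_compl⟩

instance : Top (RegularClosed X) := ⟨⟨univ, by simp⟩⟩

instance : Bot (RegularClosed X) := ⟨⟨∅, by simp⟩⟩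

instance : SupSet (RegularClosed X) :=
  ⟨fun S => ofOpen (⋃ F ∈ S, interior (F : Set X)) (isOpen_biUnion fun _ _ => isOpen_interior)⟩

instance : InfSet (RegularClosed X) :=
  ⟨fun S => ofOpen (interior (⋂ F ∈ S, (F : Set X))) isOpen_interior⟩

theorem coe_sup (F G : RegularClosed X) : ((F ⊔ G : RegularClosed X) : Set X) = (F : Set X) ∪ G := rfl

theorem coe_inf (F G : RegularClosed X) :
    ((F ⊓ G : RegularClosed X) : Set X) = closure (interior ((F : Set X) ∩ G)) := rfl

theorem coe_compl (F : RegularClosed X) :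
    ((Fᶜ : RegularClosed X) : Set X) = closure (F : Set X)ᶜ := rfl

theorem coe_top : ((⊤ : RegularClosed X) : Set X) = univ := rfl

theorem coe_bot : ((⊥ : RegularClosed X) : Set X) = ∅ := rfl

theorem coe_inf_subset (F G : RegularClosed X) :
    ((F ⊓ G : RegularClosed X) : Set X) ⊆ (F : Set X) ∩ G :=
  closure_minimal interior_subset (F.isClosed.inter G.isClosed)

instance : CompleteBooleanAlgebra (RegularClosed X) where
  sup := (· ⊔ ·)
  inf := (· ⊓ ·)
  le_sup_left _ _ := subset_union_left
  le_sup_right _ _ := subset_union_right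
  sup_le _ _ _ h₁ h₂ := union_subset h₁ h₂
  inf_le_left F G := (coe_inf_subset F G).trans inter_subset_left
  inf_le_right F G := (coe_inf_subset F G).trans inter_subset_right
  le_inf _ _ _ h₁ h₂ := le_ofOpen (interior_mono (subset_inter h₁ h₂))
  isLUB_sSup S := by
    refine ⟨fun F hF => le_ofOpen (subset_biUnion_of_mem (u := fun F : RegularClosed X =>
      interior (F : Set X)) hF), fun G hG => ofOpen_le_iff.mpr ?_⟩
    exact iUnion₂_subset fun F hF => interior_subset.trans (coe_le_coe.mpr (hG hF))
  isGLB_sInf S := by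
    refine ⟨fun F hF => ofOpen_le_iff.mpr (interior_subset.trans (biInter_subset_of_mem hF)),
      fun G hG => le_ofOpen (interior_mono (subset_iInter₂ fun F hF => hG hF))⟩
  le_sup_inf F G H := by
    rw [← coe_le_coe, coe_sup, coe_inf, coe_inf, coe_sup, coe_sup, ← union_inter_distrib_left]
    -- As `F` is closed, the interior of `F ∪ (G ∩ H)` lies in `F ∪ interior (G ∩ H)`.
    refine closure_minimal ((F.isClosed.interior_union_left).trans ?_)
      (F.isClosed.union isClosed_closure)
    exact union_subset_union_right _ subset_closure
  inf_compl_le_bot F := by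
    refine ofOpen_le_iff.mpr ?_
    rw [interior_inter, coe_compl, coe_bot, closure_compl]
    exact fun x hx => interior_subset hx.2 hx.1
  top_le_sup_compl F := by
    rw [← coe_le_coe, coe_sup, coe_compl, coe_top]
    exact fun x _ => (em (x ∈ F)).imp id fun h => subset_closure h
  le_top _ := subset_univ _
  bot_le _ := empty_subset _

theorem eq_bot_iff_coe {F : RegularClosed X} : F = ⊥ ↔ (F : Set X) = ∅ := by
  rw [← SetLike.coe_set_eq, coe_bot]

theorem ne_bot_iff {F : RegularClosed X} : F ≠ ⊥ ↔ (F : Set X).Nonempty := by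
  rw [nonempty_iff_ne_empty, Ne, eq_bot_iff_coe]

theorem disjoint_interior_compl (F : RegularClosed X) :
    Disjoint (interior (F : Set X)) (Fᶜ : RegularClosed X) := by
  rw [coe_compl, closure_compl]
  exact disjoint_compl_right

theorem mem_interior_inf {F G : RegularClosed X} {x : X} (hF : x ∈ interior (F : Set X))
    (hG : x ∈ interior (G : Set X)) : x ∈ interior ((F ⊓ G : RegularClosed X) : Set X) := by
  refine interior_maximal (coe_inf F G ▸ subset_closure) isOpen_interior ?_
  rw [interior_inter]
  exact ⟨hF, hG⟩

theorem exists_mem_interior_subset [RegularSpace X] {x : X} {U : Set X} (hU : U ∈ 𝓝 x) :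
    ∃ F : RegularClosed X, x ∈ interior (F : Set X) ∧ (F : Set X) ⊆ U := by
  obtain ⟨V, hV, hVc, hVU⟩ := exists_mem_nhds_isClosed_subset hU
  refine ⟨ofOpen (interior V) isOpen_interior,
    interior_maximal subset_closure isOpen_interior (mem_interior_iff_mem_nhds.mpr hV), ?_⟩
  exact (closure_minimal interior_subset hVc).trans hVU

/-- Two regular closed sets are in contact when they meet. -/
def Contact (F G : RegularClosed X) : Prop := ((F : Set X) ∩ G).Nonempty

end Order

theorem isNormalContact_contact (X : Type u) [TopologicalSpace X] [CompactSpace X] [T2Space X] :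
    IsNormalContact (Contact (X := X)) where
  self_of_ne_bot F hF := by
    rw [Contact, inter_self]
    exact ne_bot_iff.mp hF
  ne_bot F G h := ⟨ne_bot_iff.mpr h.left, ne_bot_iff.mpr h.right⟩
  symm F G h := by
    rw [Contact, inter_comm]
    exact h
  sup_iff F G H := by
    rw [Contact, coe_sup, inter_union_distrib_left, union_nonempty]
    rfl
  interpolate F G h := by
    have hd : Disjoint (F : Set X) G :=
      disjoint_iff_inter_eq_empty.mpr (not_nonempty_iff_eq_empty.mp h)
    obtain ⟨V, U, hV, hU, hFV, hGU, hVU⟩ := normal_separation F.isClosed G.isClosed hd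
    refine ⟨ofOpen U hU, ?_, ?_⟩
    · rintro ⟨x, hxF, hxU⟩
      exact (hVU.closure_right hV).le_bot ⟨hFV hxF, hxU⟩
    · rintro ⟨x, hxG, hxU⟩
      have hsub : (((ofOpen U hU)ᶜ : RegularClosed X) : Set X) ⊆ Uᶜ := by
        refine closure_minimal (compl_subset_compl.mpr subset_closure) hU.isClosed_compl
      exact hsub hxU (hGU hxG)
  exists_far F hF := by
    have : (F : Set X) ≠ univ := fun h => hF (SetLike.coe_injective h)
    obtain ⟨x, hx⟩ := (ne_univ_iff_exists_notMem _).mp this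
    obtain ⟨G, hxG, hGF⟩ := exists_mem_interior_subset (F.isClosed.isOpen_compl.mem_nhds hx)
    refine ⟨G, ne_bot_iff.mpr ⟨x, interior_subset hxG⟩, ?_⟩
    rintro ⟨y, hyG, hyF⟩
    exact hGF hyG hyF

/-! ### Preimages and direct images under open maps. -/

section Preimage

variable {X Y : Type*} [TopologicalSpace X] [TopologicalSpace Y]

/-- The preimage of a regular closed set under a continuous open map. -/
def preimage (f : X → Y) (hf : Continuous f) (hfo : IsOpenMap f) (G : RegularClosed Y) :
    RegularClosed X where
  carrier := f ⁻¹' G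
  closure_interior' := by
    rw [← hfo.preimage_interior_eq_interior_preimage hf,
      ← hfo.preimage_closure_eq_closure_preimage hf, G.closure_interior]

theorem coe_preimage {f : X → Y} (hf : Continuous f) (hfo : IsOpenMap f) (G : RegularClosed Y) :
    (preimage f hf hfo G : Set X) = f ⁻¹' G := rfl

end Preimage

section Image

variable {X Y : Type*} [TopologicalSpace X] [CompactSpace X] [TopologicalSpace Y]
  [T2Space Y]

theorem coe_image_closure {f : X → Y} (hf : Continuous f) (s : Set X) :
    f '' closure s = closure (f '' s) :=
  (hf.isClosedMap.closure_image_eq_of_continuous hf s).symm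

/-- The image of a regular closed set under a continuous open map between compact Hausdorff
spaces. -/
def image (f : X → Y) (hf : Continuous f) (hfo : IsOpenMap f) (F : RegularClosed X) :
    RegularClosed Y where
  carrier := f '' F
  closure_interior' := by
    refine (closure_minimal interior_subset (hf.isClosedMap _ F.isClosed)).antisymm ?_
    conv_lhs => rw [← F.closure_interior, coe_image_closure hf]
    exact closure_mono (interior_maximal (image_mono interior_subset) (hfo _ isOpen_interior))

variable {f : X → Y} (hf : Continuous f) (hfo : IsOpenMap f)

theorem coe_image (F : RegularClosed X) : (image f hf hfo F : Set Y) = f '' F := rfl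

theorem gc_image_preimage : GaloisConnection (image f hf hfo) (preimage f hf hfo) :=
  fun _ _ => image_subset_iff

theorem image_eq_bot_iff (F : RegularClosed X) : image f hf hfo F = ⊥ ↔ F = ⊥ := by
  rw [eq_bot_iff_coe, eq_bot_iff_coe, coe_image, image_eq_empty]

theorem image_sSup (S : Set (RegularClosed X)) :
    image f hf hfo (sSup S) = sSup (image f hf hfo '' S) := by
  rw [GaloisConnection.l_sSup (gc_image_preimage hf hfo), sSup_image]

/-- The witness is the meet of `F` with the preimage of `G`. Its image is all of `G` because `f
(interior F)` is dense in `f(F)`, hence its trace on the open set `interior G` is dense there. -/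
theorem exists_le_image_eq (F : RegularClosed X) (G : RegularClosed Y)
    (h : G ≤ image f hf hfo F) : ∃ H ≤ F, image f hf hfo H = G := by
  refine ⟨F ⊓ preimage f hf hfo G, inf_le_left, le_antisymm ?_ ?_⟩
  · exact ((gc_image_preimage hf hfo) _ _).mpr inf_le_right
  · rw [← coe_le_coe, coe_image, coe_inf, coe_image_closure hf, coe_preimage, interior_inter]
    have hG : interior (G : Set Y) ⊆ closure (f '' interior (F : Set X)) := by
      rw [← coe_image_closure hf, F.closure_interior]
      exact interior_subset.trans (coe_le_coe.mpr h)
    have h₁ : f '' interior (F : Set X) ∩ interior (G : Set Y) ⊆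
        f '' (interior (F : Set X) ∩ interior (f ⁻¹' (G : Set Y))) := by
      rintro _ ⟨⟨x, hx, rfl⟩, hxG⟩
      exact ⟨x, ⟨hx, preimage_interior_subset_interior_preimage hf hxG⟩, rfl⟩
    calc (G : Set Y) = closure (interior (G : Set Y)) := G.closure_interior.symm
      _ ⊆ closure (closure (f '' interior (F : Set X)) ∩ interior (G : Set Y)) :=
        closure_mono (subset_inter hG Subset.rfl)
      _ ⊆ closure (closure (f '' interior (F : Set X) ∩ interior (G : Set Y))) :=
        closure_mono isOpen_interior.closure_inter
      _ = closure (f '' interior (F : Set X) ∩ interior (G : Set Y)) := closure_closure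
      _ ⊆ _ := closure_mono h₁

theorem contact_image {F G : RegularClosed X} (h : F.Contact G) :
    (image f hf hfo F).Contact (image f hf hfo G) :=
  (h.image f).mono (image_inter_subset _ _ _)

theorem contact_preimage {F : RegularClosed X} {G : RegularClosed Y}
    (h : (image f hf hfo F).Contact G) : F.Contact (preimage f hf hfo G) := by
  obtain ⟨_, ⟨x, hx, rfl⟩, hxG⟩ := h
  exact ⟨x, hx, hxG⟩

end Image

/-- If `f x ≠ g x`, some neighbourhood `F` of `x` has `g(F)` missing `f x`, although `f x` lies in
`f(F)`. -/
theorem eq_of_image_eq {X Y : Type*} [TopologicalSpace X] [RegularSpace X]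
    [TopologicalSpace Y] [T1Space Y] {f g : X → Y} (hg : Continuous g)
    (h : ∀ F : RegularClosed X, f '' F = g '' F) : f = g := by
  funext x
  by_contra hne
  obtain ⟨F, hxF, hF⟩ := exists_mem_interior_subset
    ((isOpen_compl_singleton.preimage hg).mem_nhds (show x ∈ g ⁻¹' {f x}ᶜ from Ne.symm hne))
  obtain ⟨z, hz, hzx⟩ := (h F).le ⟨x, interior_subset hxF, rfl⟩
  exact hF hz hzx

end RegularClosed

end ContactDuality

/-! ### Recovering an open map from a morphism of algebras. -/

namespace ContactDuality

open Set Topology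

namespace RegularClosed

section Reconstruct

/-- A monotone family of nonempty closed sets, indexed by the regular closed neighbourhoods of a
point, has a common point. -/
theorem exists_forall_mem_of_mem_interior {X Y : Type*} [TopologicalSpace X]
    [TopologicalSpace Y] [CompactSpace Y] (x : X) (T : RegularClosed X → Set Y) (hT : Monotone T)
    (hTc : ∀ F, IsClosed (T F))
    (hTn : ∀ F : RegularClosed X, x ∈ interior (F : Set X) → (T F).Nonempty) :
    ∃ y, ∀ F : RegularClosed X, x ∈ interior (F : Set X) → y ∈ T F := by
  let ι := {F : RegularClosed X // x ∈ interior (F : Set X)}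
  have : Nonempty ι := ⟨⟨⊤, by change x ∈ interior univ; simp⟩⟩
  obtain ⟨y, hy⟩ := IsCompact.nonempty_iInter_of_directed_nonempty_isCompact_isClosed
    (fun F : ι => T F.1)
    (fun F G => ⟨⟨F.1 ⊓ G.1, mem_interior_inf F.2 G.2⟩, hT inf_le_left, hT inf_le_right⟩)
    (fun F => hTn F.1 F.2) (fun F => (hTc F.1).isCompact) (fun F => hTc F.1)
  exact ⟨y, fun F hF => mem_iInter.mp hy ⟨F, hF⟩⟩

variable {X Y : Type*} [TopologicalSpace X] [CompactSpace X] [T2Space X]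
  [TopologicalSpace Y] [CompactSpace Y] [T2Space Y]

theorem mem_of_forall_contact {y : Y} {G : RegularClosed Y}
    (h : ∀ H : RegularClosed Y, y ∈ interior (H : Set Y) → G.Contact H) : y ∈ G := by
  by_contra hy
  obtain ⟨H, hyH, hH⟩ := exists_mem_interior_subset (G.isClosed.isOpen_compl.mem_nhds hy)
  obtain ⟨z, hzG, hzH⟩ := h H hyH
  exact hH hzH hzG

/-- A left adjoint `ψ` between algebras of regular closed sets that preserves contact, reflects
`⊥` and satisfies `ψ F C G → F C φ G` for its right adjoint `φ`, is the image map of a continuous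
open map. -/
theorem exists_continuous_isOpenMap_image_eq (ψ : RegularClosed X → RegularClosed Y)
    (φ : RegularClosed Y → RegularClosed X) (gc : GaloisConnection ψ φ)
    (hbot : ∀ F, ψ F = ⊥ ↔ F = ⊥) (hC : ∀ F G, F.Contact G → (ψ F).Contact (ψ G))
    (hCφ : ∀ F G, (ψ F).Contact G → F.Contact (φ G)) :
    ∃ f : X → Y, Continuous f ∧ IsOpenMap f ∧ ∀ F : RegularClosed X, f '' F = ψ F := by
  have hψφ : ∀ F G, F.Contact (φ G) → (ψ F).Contact G := fun F G h =>
    (hC _ _ h).mono (inter_subset_inter_right _ (gc.l_u_le G))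
  have hex : ∀ x : X, ∃ y, ∀ F : RegularClosed X, x ∈ interior (F : Set X) → y ∈ ψ F := fun x =>
    exists_forall_mem_of_mem_interior x (fun F => (ψ F : Set Y)) gc.monotone_l
      (fun F => (ψ F).isClosed) fun F hF => ne_bot_iff.mp fun h =>
        ne_bot_iff.mpr ⟨x, interior_subset hF⟩ ((hbot F).mp h)
  choose f hf using hex
  -- Each neighbourhood `F` of `x` has `y ∈ ψ F ∩ G`, so (EC7) puts `F` in contact with `φ G`;
  -- closedness of `φ G` gives `x ∈ φ G`.
  have mem_φ : ∀ x (y : Y), (∀ F : RegularClosed X, x ∈ interior (F : Set X) → y ∈ ψ F) →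
      ∀ G : RegularClosed Y, y ∈ G → x ∈ φ G := fun x y hy G hG =>
    mem_of_forall_contact fun F hF => by
      obtain ⟨z, hz⟩ := hCφ F G ⟨y, hy F hF, hG⟩
      exact ⟨z, hz.2, hz.1⟩
  -- Disjoint neighbourhoods `G`, `H` of two candidates would have `x` in both `φ G` and `φ H`, so
  -- `ψ (φ G) ≤ G` and `ψ (φ H) ≤ H` would be in contact.
  have huniq : ∀ x (y : Y), (∀ F : RegularClosed X, x ∈ interior (F : Set X) → y ∈ ψ F) →
      y = f x := by
    intro x y hy
    by_contra hne
    obtain ⟨U, V, hU, hV, hyU, hxV, hUV⟩ := t2_separation hne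
    obtain ⟨G, hyG, hGU⟩ := exists_mem_interior_subset (hU.mem_nhds hyU)
    obtain ⟨H, hxH, hHV⟩ := exists_mem_interior_subset (hV.mem_nhds hxV)
    obtain ⟨z, hzG, hzH⟩ := hC _ _ ⟨x, mem_φ x y hy G (interior_subset hyG),
      mem_φ x (f x) (hf x) H (interior_subset hxH)⟩
    exact hUV.le_bot ⟨hGU (coe_le_coe.mpr (gc.l_u_le G) hzG),
      hHV (coe_le_coe.mpr (gc.l_u_le H) hzH)⟩
  have map_mem : ∀ (F : RegularClosed X), ∀ x ∈ F, f x ∈ ψ F := fun F x hx =>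
    mem_of_forall_contact fun G hG => hψφ F G
      ⟨x, hx, mem_φ x (f x) (hf x) G (interior_subset hG)⟩
  have himage : ∀ F : RegularClosed X, f '' F = ψ F := by
    intro F
    refine (image_subset_iff.mpr (map_mem F)).antisymm fun y hy => ?_
    -- A preimage of `y` in `F` is found as a common point of the sets `F ∩ φ G`, with `G` ranging
    -- over neighbourhoods of `y`.
    obtain ⟨x, hx⟩ := exists_forall_mem_of_mem_interior y (fun G => (F : Set X) ∩ φ G)
      (fun G H h => inter_subset_inter_right _ (gc.monotone_u h))
      (fun G => F.isClosed.inter (φ G).isClosed)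
      fun G hG => hCφ F G ⟨y, hy, interior_subset hG⟩
    have hxF : x ∈ F := (hx ⊤ (by rw [coe_top, interior_univ]; trivial)).1
    refine ⟨x, hxF, ?_⟩
    by_contra hne
    obtain ⟨G, hyG, hG⟩ := exists_mem_interior_subset
      (isOpen_compl_singleton.mem_nhds (show y ∈ {f x}ᶜ from Ne.symm hne))
    exact hG (coe_le_coe.mpr (gc.l_u_le G) (map_mem _ x (hx G hyG).2)) rfl
  refine ⟨f, continuous_iff_continuousAt.mpr fun x => ?_, fun U hU => ?_, himage⟩
  · rw [ContinuousAt, (nhds_basis_opens (f x)).tendsto_right_iff]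
    rintro V ⟨hxV, hV⟩
    by_contra hcon
    -- If continuity failed, every `ψ F` would meet `Vᶜ`; compactness gives a candidate value at `x`
    -- outside `V`, against uniqueness.
    obtain ⟨y, hy⟩ := exists_forall_mem_of_mem_interior x (fun F => (ψ F : Set Y) ∩ Vᶜ)
      (fun F G h => inter_subset_inter_left _ (gc.monotone_l h))
      (fun F => (ψ F).isClosed.inter hV.isClosed_compl) fun F hF => by
        by_contra hne
        refine hcon (Filter.mem_of_superset (mem_interior_iff_mem_nhds.mp hF) fun z hz => ?_)
        by_contra hzV
        exact hne ⟨f z, map_mem F z hz, hzV⟩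
    refine (hy ⊤ (by rw [coe_top, interior_univ]; trivial)).2 ?_
    rw [huniq x y fun F hF => (hy F hF).1]
    exact hxV
  · rw [isOpen_iff_mem_nhds]
    rintro _ ⟨x, hx, rfl⟩
    obtain ⟨F, hxF, hFU⟩ := exists_mem_interior_subset (hU.mem_nhds hx)
    refine Filter.mem_of_superset ?_ (image_mono hFU)
    rw [himage, ← mem_interior_iff_mem_nhds]
    by_contra hint
    have hmem : f x ∈ (ψ F)ᶜ := by
      change f x ∈ (((ψ F)ᶜ : RegularClosed Y) : Set Y)
      rwa [coe_compl, closure_compl]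
    -- `ψ` sends the meet of `F` and `φ (ψ F)ᶜ` below both `ψ F` and its complement, hence to `⊥`,
    -- and `ψ` reflects `⊥`.
    have hle : φ (ψ F)ᶜ ≤ Fᶜ := by
      rw [le_compl_iff_disjoint_right, disjoint_iff, ← hbot, eq_bot_iff,
        ← compl_inf_eq_bot (a := ψ F)]
      exact le_inf ((gc.monotone_l inf_le_left).trans (gc.l_u_le _)) (gc.monotone_l inf_le_right)
    exact F.disjoint_interior_compl.le_bot ⟨hxF, hle (mem_φ x (f x) (hf x) _ hmem)⟩

end Reconstruct

end RegularClosed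

end ContactDuality

/-! ### Prime ideals and clusters. -/

namespace ContactDuality

open Set Topology

namespace IsNormalContact

variable {A : Type u} [BooleanAlgebra A] {C : A → A → Prop}

theorem mono (hC : IsNormalContact C) {a a' b b' : A} (h : C a b) (ha : a ≤ a') (hb : b ≤ b') :
    C a' b' := by
  have mono_right : ∀ {a b b' : A}, C a b → b ≤ b' → C a b' := fun {a b b'} h hb => by
    rw [← sup_eq_right.mpr hb]
    exact (hC.sup_iff a b b').mpr (Or.inl h)
  exact hC.symm _ _ (mono_right (hC.symm _ _ (mono_right h hb)) ha)

theorem sup_left_iff (hC : IsNormalContact C) {a b c : A} : C (a ⊔ b) c ↔ C a c ∨ C b c := by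
  have comm : ∀ {a b : A}, C a b ↔ C b a := ⟨hC.symm _ _, hC.symm _ _⟩
  rw [comm, hC.sup_iff, comm (a := c), comm (a := c)]

theorem of_ne_bot (hC : IsNormalContact C) {a b : A} (h : a ⊓ b ≠ ⊥) : C a b :=
  hC.mono (hC.self_of_ne_bot _ h) inf_le_left inf_le_right

end IsNormalContact

/-- If `P` cuts out an ideal that misses `a`, then some prime ideal containing it misses `a`. -/
theorem exists_isPrime_of_not {A : Type u} [BooleanAlgebra A] (P : A → Prop) (hbot : P ⊥)
    (hsup : ∀ a b, P a → P b → P (a ⊔ b)) (hle : ∀ a b, a ≤ b → P b → P a) {a : A} (ha : ¬ P a) :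
    ∃ I : Order.Ideal A, I.IsPrime ∧ (∀ c, P c → c ∈ I) ∧ a ∉ I := by
  let J : Order.Ideal A :=
    { carrier := {c | P c}
      lower' := fun b a h hb => hle a b h hb
      nonempty' := ⟨⊥, hbot⟩
      directed' := fun b hb c hc => ⟨b ⊔ c, hsup b c hb hc, le_sup_left, le_sup_right⟩ }
  have hd : Disjoint (Order.PFilter.principal a : Set A) J := by
    rw [Set.disjoint_left]
    intro b hb hbJ
    exact ha (hle a b (Order.PFilter.mem_principal.mp hb) hbJ)
  obtain ⟨I, hI, hJI, hdI⟩ := DistribLattice.prime_ideal_of_disjoint_filter_ideal hd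
  exact ⟨I, hI, fun c hc => hJI hc,
    Set.disjoint_left.mp hdI (Order.PFilter.mem_principal.mpr le_rfl)⟩

/-- The cluster of elements in contact with every element of the ultrafilter complementary to a
prime ideal `I`. -/
def cluster {A : Type u} [BooleanAlgebra A] (C : A → A → Prop) (I : Order.Ideal A) : Set A :=
  {a | ∀ b, b ∉ I → C a b}

section Cluster

variable {A : Type u} [BooleanAlgebra A] {C : A → A → Prop} {I J : Order.Ideal A}

theorem inf_notMem (hI : I.IsPrime) {a b : A} (ha : a ∉ I) (hb : b ∉ I) : a ⊓ b ∉ I :=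
  fun h => (hI.mem_or_mem h).elim ha hb

theorem bot_notMem_cluster (hC : IsNormalContact C) (hI : I.IsPrime) : ⊥ ∉ cluster C I :=
  fun h => (hC.ne_bot _ _ (h ⊤ hI.toIsProper.top_notMem)).1 rfl

theorem mem_cluster_of_notMem (hC : IsNormalContact C) (hI : I.IsPrime) {a : A} (ha : a ∉ I) :
    a ∈ cluster C I :=
  fun _ hb => hC.of_ne_bot fun h => inf_notMem hI ha hb (h ▸ I.bot_mem)

theorem sup_mem_cluster_iff (hC : IsNormalContact C) (hI : I.IsPrime) {a b : A} :
    a ⊔ b ∈ cluster C I ↔ a ∈ cluster C I ∨ b ∈ cluster C I := by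
  refine ⟨fun h => ?_, ?_⟩
  · by_contra! hab
    simp only [cluster, mem_ofPred_eq, not_forall] at hab
    obtain ⟨⟨c, hcI, hc⟩, d, hdI, hd⟩ := hab
    rcases hC.sup_left_iff.mp (h _ (inf_notMem hI hcI hdI)) with h | h
    · exact hc (hC.mono h le_rfl inf_le_left)
    · exact hd (hC.mono h le_rfl inf_le_right)
  · rintro (h | h) c hc
    · exact hC.mono (h c hc) le_sup_left le_rfl
    · exact hC.mono (h c hc) le_sup_right le_rfl

/-- Were `a` not in contact with some `b ∉ I`, (C5) would separate them by some `c`. Either `c ∉ J`,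
against `a ∈ cluster C J`, or `cᶜ ∉ J`, so `cᶜ` would touch `b`. -/
theorem cluster_subset_of_forall_notMem (hC : IsNormalContact C) (hJ : J.IsPrime)
    (h : ∀ a, a ∉ J → a ∈ cluster C I) : cluster C J ⊆ cluster C I := by
  intro a ha b hb
  by_contra hab
  obtain ⟨c, hac, hbc⟩ := hC.interpolate a b hab
  by_cases hcJ : c ∈ J
  · exact hbc (hC.symm _ _ (h _ (fun hc => hJ.toIsProper.notMem_of_compl_mem hc hcJ) b hb))
  · exact hac (ha c hcJ)

theorem cluster_eq_of_forall_notMem (hC : IsNormalContact C) (hI : I.IsPrime) (hJ : J.IsPrime)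
    (h : ∀ a, a ∉ J → a ∈ cluster C I) : cluster C J = cluster C I :=
  (cluster_subset_of_forall_notMem hC hJ h).antisymm
    (cluster_subset_of_forall_notMem hC hI fun a ha b hb => hC.symm _ _ (h b hb a ha))

/-- The elements outside a cluster form an ideal. A prime ideal containing it and missing `a` has
its complement inside the cluster, and this forces equal clusters. -/
theorem exists_isPrime_cluster_eq (hC : IsNormalContact C) (hI : I.IsPrime) {a : A}
    (ha : a ∈ cluster C I) : ∃ J : Order.Ideal A, J.IsPrime ∧ a ∉ J ∧ cluster C J = cluster C I := by
  obtain ⟨J, hJ, hP, haJ⟩ := exists_isPrime_of_not (fun c => ∃ b, b ∉ I ∧ ¬ C c b)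
    ⟨⊤, hI.toIsProper.top_notMem, fun h => (hC.ne_bot _ _ h).1 rfl⟩
    (by
      rintro c d ⟨b, hb, hcb⟩ ⟨e, he, hde⟩
      refine ⟨b ⊓ e, inf_notMem hI hb he, fun h => ?_⟩
      rcases hC.sup_left_iff.mp h with h | h
      · exact hcb (hC.mono h le_rfl inf_le_left)
      · exact hde (hC.mono h le_rfl inf_le_right))
    (fun c d hcd ⟨b, hb, hdb⟩ => ⟨b, hb, fun h => hdb (hC.mono h hcd le_rfl)⟩)
    (a := a) (fun ⟨b, hb, hab⟩ => hab (ha b hb))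
  refine ⟨J, hJ, haJ, cluster_eq_of_forall_notMem hC hI hJ fun c hc b hb => ?_⟩
  by_contra hcb
  exact hc (hP c ⟨b, hb, hcb⟩)

theorem exists_isPrime_of_contact (hC : IsNormalContact C) {a b : A} (h : C a b) :
    ∃ I : Order.Ideal A, I.IsPrime ∧ a ∉ I ∧ b ∈ cluster C I := by
  obtain ⟨I, hI, hP, haI⟩ := exists_isPrime_of_not (fun c => ¬ C c b)
    (fun h => (hC.ne_bot _ _ h).1 rfl)
    (fun c d hc hd h => (hC.sup_left_iff.mp h).elim hc hd)
    (fun c d hcd hd h => hd (hC.mono h hcd le_rfl)) (a := a) (not_not.mpr h)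
  refine ⟨I, hI, haI, fun c hc => ?_⟩
  by_contra hbc
  exact hc (hP c fun h => hbc (hC.symm _ _ h))

end Cluster

/-- The space of clusters of a contact algebra. -/
def ClusterSpace {A : Type u} [BooleanAlgebra A] (C : A → A → Prop) : Type u :=
  {σ : Set A // ∃ I : Order.Ideal A, I.IsPrime ∧ cluster C I = σ}

/-! ### The topology of the cluster space. -/

namespace ClusterSpace

variable {A : Type u} [BooleanAlgebra A] {C : A → A → Prop}

/-- The set of clusters containing `a`. -/
def locus (C : A → A → Prop) (a : A) : Set (ClusterSpace C) := {σ | a ∈ σ.1}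

instance : TopologicalSpace (ClusterSpace C) :=
  TopologicalSpace.generateFrom (range fun a => (locus C a)ᶜ)

theorem isClosed_locus (a : A) : IsClosed (locus C a) :=
  ⟨TopologicalSpace.isOpen_generateFrom_of_mem ⟨a, rfl⟩⟩

theorem locus_sup (hC : IsNormalContact C) (a b : A) :
    locus C (a ⊔ b) = locus C a ∪ locus C b := by
  ext ⟨_, I, hI, rfl⟩
  exact sup_mem_cluster_iff hC hI

theorem locus_mono (hC : IsNormalContact C) {a b : A} (h : a ≤ b) : locus C a ⊆ locus C b := by
  rw [← sup_eq_right.mpr h, locus_sup hC]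
  exact subset_union_left

theorem locus_bot (hC : IsNormalContact C) : locus C ⊥ = ∅ := by
  refine eq_empty_of_forall_notMem ?_
  rintro ⟨_, I, hI, rfl⟩
  exact bot_notMem_cluster hC hI

/-- By (C6), `a ≠ ⊤` leaves room for some `b ≠ ⊥` far from `a`; the cluster of an ultrafilter
through `b` omits `a`. -/
theorem locus_eq_univ_iff (hC : IsNormalContact C) {a : A} : locus C a = univ ↔ a = ⊤ := by
  constructor
  · intro h
    by_contra ha
    obtain ⟨b, hb, hba⟩ := hC.exists_far a ha
    obtain ⟨I, hI, hbI, -⟩ := exists_isPrime_of_contact hC (hC.self_of_ne_bot b hb)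
    have : (⟨_, I, hI, rfl⟩ : ClusterSpace C) ∈ locus C a := h ▸ mem_univ _
    exact hba (hC.symm _ _ (this b hbI))
  · rintro rfl
    refine eq_univ_of_forall ?_
    rintro ⟨_, I, hI, rfl⟩
    exact mem_cluster_of_notMem hC hI hI.toIsProper.top_notMem

theorem locus_union_eq_univ_iff (hC : IsNormalContact C) {a b : A} :
    locus C a ∪ locus C b = univ ↔ aᶜ ≤ b := by
  rw [← locus_sup hC, locus_eq_univ_iff hC, ← codisjoint_iff, codisjoint_iff_compl_le_right]

theorem locus_subset_locus_iff (hC : IsNormalContact C) {a b : A} :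
    locus C a ⊆ locus C b ↔ a ≤ b := by
  refine ⟨fun h => ?_, locus_mono hC⟩
  rw [← compl_compl a, ← locus_union_eq_univ_iff hC, ← univ_subset_iff]
  rw [← (locus_union_eq_univ_iff hC).mpr (compl_compl a).le]
  exact union_subset_union_right _ h

theorem contact_iff_nonempty_inter (hC : IsNormalContact C) {a b : A} :
    C a b ↔ (locus C a ∩ locus C b).Nonempty := by
  constructor
  · intro h
    obtain ⟨I, hI, haI, hb⟩ := exists_isPrime_of_contact hC h
    exact ⟨⟨_, I, hI, rfl⟩, mem_cluster_of_notMem hC hI haI, hb⟩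
  · rintro ⟨⟨_, I, hI, rfl⟩, ha, hb⟩
    obtain ⟨J, hJ, hbJ, hJI⟩ := exists_isPrime_cluster_eq hC hI hb
    have ha' : a ∈ cluster C J := hJI ▸ ha
    exact ha' b hbJ

theorem isTopologicalBasis_compl_locus (hC : IsNormalContact C) :
    TopologicalSpace.IsTopologicalBasis (range fun a => (locus C a)ᶜ) := by
  refine TopologicalSpace.isTopologicalBasis_of_subbasis_of_finiteInter rfl ?_
  refine ⟨⟨⊥, by simp [locus_bot hC]⟩, ?_⟩
  rintro _ ⟨a, rfl⟩ _ ⟨b, rfl⟩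
  exact ⟨a ⊔ b, by simp [locus_sup hC, compl_union]⟩

theorem t2Space (hC : IsNormalContact C) : T2Space (ClusterSpace C) := by
  refine ⟨?_⟩
  rintro ⟨_, I, hI, rfl⟩ ⟨_, J, hJ, rfl⟩ hne
  have : ∃ a, a ∉ J ∧ a ∉ cluster C I := by
    by_contra! h
    exact hne (Subtype.ext (cluster_eq_of_forall_notMem hC hI hJ h).symm)
  obtain ⟨a, haJ, haI⟩ := this
  simp only [cluster, mem_ofPred_eq, not_forall] at haI
  obtain ⟨b, hbI, hab⟩ := haI
  -- The first cluster omits `cᶜ` and the second omits `c`, while the loci of `c` and `cᶜ` cover the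
  -- space, so their complements are disjoint.
  obtain ⟨c, hac, hbc⟩ := hC.interpolate a b hab
  refine ⟨(locus C cᶜ)ᶜ, (locus C c)ᶜ, (isClosed_locus _).isOpen_compl,
    (isClosed_locus _).isOpen_compl, fun h => hbc (hC.symm _ _ (h b hbI)),
    fun h => hac (hC.symm _ _ (h a haJ)), ?_⟩
  rw [Set.disjoint_compl_left_iff_subset, compl_subset_iff_union, union_comm]
  exact (locus_union_eq_univ_iff hC).mpr (compl_compl c).le

/-- Choosing a prime ideal for each cluster, the elements lying in `𝓕`-almost all of them form a
prime ideal, whose cluster is a limit of `𝓕`. -/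
theorem compactSpace : CompactSpace (ClusterSpace C) := by
  refine ⟨isCompact_iff_ultrafilter_le_nhds.mpr fun 𝓕 _ => ?_⟩
  choose I hI hσ using fun σ : ClusterSpace C => σ.2
  let J : Order.Ideal A :=
    { carrier := {a | ∀ᶠ σ in (𝓕 : Filter (ClusterSpace C)), a ∈ I σ}
      lower' := fun b a h hb => hb.mono fun σ hσ => (I σ).lower h hσ
      nonempty' := ⟨⊥, .of_forall fun σ => (I σ).bot_mem⟩
      directed' := fun b hb c hc => ⟨b ⊔ c, (hb.and hc).mono fun σ h => (I σ).sup_mem h.1 h.2,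
        le_sup_left, le_sup_right⟩ }
  have mem_J : ∀ a, a ∈ J ↔ ∀ᶠ σ in (𝓕 : Filter (ClusterSpace C)), a ∈ I σ := fun _ => Iff.rfl
  have hJp : J.IsProper := Order.Ideal.isProper_of_notMem (p := ⊤) fun h => by
    obtain ⟨σ, hσ⟩ := ((mem_J _).mp h).exists
    exact (hI σ).toIsProper.top_notMem hσ
  have hJ : J.IsPrime := by
    refine Order.Ideal.isPrime_of_mem_or_compl_mem fun {a} => ?_
    rw [mem_J, mem_J, ← Ultrafilter.eventually_or]
    exact .of_forall fun σ => (hI σ).mem_or_compl_mem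
  let τ : ClusterSpace C := ⟨_, J, hJ, rfl⟩
  refine ⟨τ, mem_univ τ, ?_⟩
  rw [show 𝓝 τ = _ from TopologicalSpace.nhds_generateFrom]
  refine le_iInf₂ ?_
  rintro _ ⟨hmem, a, rfl⟩
  rw [Filter.le_principal_iff, Ultrafilter.mem_coe, Ultrafilter.compl_mem_iff_notMem]
  intro ha
  refine hmem fun b hb => ?_
  have hb' : ∀ᶠ σ in (𝓕 : Filter (ClusterSpace C)), b ∉ I σ := Ultrafilter.eventually_not.mpr hb
  obtain ⟨σ, hbσ, haσ⟩ := (hb'.and ha).exists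
  have haσ : a ∈ cluster C (I σ) := (hσ σ).symm ▸ haσ
  exact haσ b hbσ

/-- If a basic open set `(locus C b)ᶜ` misses `(locus C aᶜ)ᶜ`, then the loci of `b` and `aᶜ` cover
the space, so `a ≤ b` and the basic set misses `locus C a` too. -/
theorem closure_compl_locus_compl (hC : IsNormalContact C) (a : A) :
    closure (locus C aᶜ)ᶜ = locus C a := by
  refine (closure_minimal ?_ (isClosed_locus a)).antisymm ?_
  · rw [compl_subset_iff_union]
    exact (locus_union_eq_univ_iff hC).mpr (compl_compl a).le
  · intro σ hσ
    rw [(isTopologicalBasis_compl_locus hC).mem_closure_iff]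
    rintro _ ⟨b, rfl⟩ hb
    by_contra hne
    refine hb (locus_mono hC ?_ hσ)
    rw [← compl_compl a, ← locus_union_eq_univ_iff hC, union_comm, ← compl_subset_iff_union]
    intro τ hτ
    by_contra hτa
    exact hne ⟨τ, hτ, hτa⟩

/-- The clusters containing `a`, as a regular closed set. -/
def regularLocus (hC : IsNormalContact C) (a : A) : RegularClosed (ClusterSpace C) where
  carrier := locus C a
  closure_interior' := by
    rw [← closure_compl_locus_compl hC a]
    exact (RegularClosed.ofOpen _ (isClosed_locus aᶜ).isOpen_compl).closure_interior

theorem coe_regularLocus (hC : IsNormalContact C) (a : A) :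
    (regularLocus hC a : Set (ClusterSpace C)) = locus C a := rfl

end ClusterSpace

namespace ClusterSpace

variable {A : Type u} [CompleteBooleanAlgebra A] {C : A → A → Prop}

/-- A closed `F` is the intersection of the loci containing it, so the locus of the infimum lies in
`F`. Conversely, a basic set `(locus C c)ᶜ` inside `F` forces `cᶜ` below the infimum, so the
interior of `F` lies in that locus. -/
theorem regularLocus_surjective (hC : IsNormalContact C) :
    Function.Surjective (regularLocus hC) := by
  intro F
  refine ⟨sInf {b | (F : Set (ClusterSpace C)) ⊆ locus C b}, le_antisymm ?_ ?_⟩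
  · intro σ hσ
    by_contra hσF
    obtain ⟨_, ⟨b, rfl⟩, hb, hbF⟩ := (isTopologicalBasis_compl_locus hC).exists_subset_of_mem_open
      (show σ ∈ (F : Set (ClusterSpace C))ᶜ from hσF) F.isClosed.isOpen_compl
    exact hb (locus_mono hC (sInf_le (compl_subset_compl.mp hbF)) hσ)
  · rw [← RegularClosed.coe_le_coe, coe_regularLocus, ← F.closure_interior]
    refine closure_minimal (fun σ hσ => ?_) (isClosed_locus _)
    obtain ⟨_, ⟨c, rfl⟩, hc, hcF⟩ := (isTopologicalBasis_compl_locus hC).exists_subset_of_mem_open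
      hσ isOpen_interior
    have hle : cᶜ ≤ sInf {b | closure (interior (F : Set (ClusterSpace C))) ⊆ locus C b} := by
      refine le_sInf fun b hb => ?_
      rw [← locus_union_eq_univ_iff hC, ← compl_subset_iff_union]
      exact hcF.trans (subset_closure.trans hb)
    refine locus_mono hC hle ?_
    exact (((locus_union_eq_univ_iff hC).mpr le_rfl).ge (mem_univ σ)).resolve_left hc

/-- A complete normal contact algebra is isomorphic to the algebra of regular closed sets of its
space of clusters. -/
noncomputable def regularLocusIso (hC : IsNormalContact C) :
    A ≃o RegularClosed (ClusterSpace C) where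
  toEquiv := Equiv.ofBijective (regularLocus hC)
    ⟨fun _ _ h => le_antisymm
      ((locus_subset_locus_iff hC).mp (congrArg RegularClosed.carrier h).le)
      ((locus_subset_locus_iff hC).mp (congrArg RegularClosed.carrier h).ge),
      regularLocus_surjective hC⟩
  map_rel_iff' := locus_subset_locus_iff hC

end ClusterSpace

end ContactDuality

/-! ### The functor and the equivalence. -/

namespace ContactDuality

open RegularClosed

theorem rightAdj_eq_of_gc {A B : Type u} [CompleteLattice A] [CompleteLattice B] {ψ : A → B}
    {φ : B → A} (gc : GaloisConnection ψ φ) : rightAdj ψ = φ :=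
  funext fun b => le_antisymm (sSup_le fun _ ha => gc.le_u ha) (le_sSup (gc.l_u_le b))

/-- The complete normal contact algebra of regular closed sets of a compact Hausdorff space. -/
abbrev regularClosedAlgebra (X : Type u) [TopologicalSpace X] [CompactSpace X] [T2Space X] :
    ESkeC.{u} where
  carrier := RegularClosed X
  C := Contact
  isNormalContact := isNormalContact_contact X

/-- The image map of a continuous open map, as a morphism of `ESkeC`. -/
def imageHom {X Y : Type u} [TopologicalSpace X] [CompactSpace X] [T2Space X]
    [TopologicalSpace Y] [CompactSpace Y] [T2Space Y] (f : X → Y) (hf : Continuous f)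
    (hfo : IsOpenMap f) : regularClosedAlgebra X ⟶ regularClosedAlgebra Y :=
  ({ toFun := image f hf hfo
     eq_bot_iff := image_eq_bot_iff hf hfo
     map_sSup := image_sSup hf hfo
     exists_preimage := exists_le_image_eq hf hfo
     map_contact := fun _ _ h => contact_image hf hfo h } :
    ESkeHom (regularClosedAlgebra X) (regularClosedAlgebra Y))

theorem condEC7_imageHom {X Y : Type u} [TopologicalSpace X] [CompactSpace X] [T2Space X]
    [TopologicalSpace Y] [CompactSpace Y] [T2Space Y] (f : X → Y) (hf : Continuous f)
    (hfo : IsOpenMap f) : condEC7 (imageHom f hf hfo) := by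
  intro F G h
  rw [show rightAdj (ESkeHom.toFun (imageHom f hf hfo)) = preimage f hf hfo from
    rightAdj_eq_of_gc (gc_image_preimage hf hfo)]
  exact contact_preimage hf hfo h

theorem imageHom_id (X : Type u) [TopologicalSpace X] [CompactSpace X] [T2Space X] :
    imageHom (id : X → X) continuous_id IsOpenMap.id = 𝟙 (regularClosedAlgebra X) :=
  ESkeHom.ext <| funext fun F : RegularClosed X => SetLike.coe_injective (Set.image_id (F : Set X))

theorem imageHom_comp {X Y Z : Type u} [TopologicalSpace X] [CompactSpace X] [T2Space X]
    [TopologicalSpace Y] [CompactSpace Y] [T2Space Y] [TopologicalSpace Z] [CompactSpace Z]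
    [T2Space Z] {f : X → Y} (hf : Continuous f) (hfo : IsOpenMap f) {g : Y → Z}
    (hg : Continuous g) (hgo : IsOpenMap g) :
    imageHom (g ∘ f) (hg.comp hf) (hgo.comp hfo) = imageHom f hf hfo ≫ imageHom g hg hgo :=
  ESkeHom.ext <| funext fun F : RegularClosed X =>
    SetLike.coe_injective (Set.image_comp g f (F : Set X))

theorem eq_of_imageHom_eq {X Y : Type u} [TopologicalSpace X] [CompactSpace X] [T2Space X]
    [TopologicalSpace Y] [CompactSpace Y] [T2Space Y] {f g : X → Y} {hf : Continuous f}
    {hfo : IsOpenMap f} {hg : Continuous g} {hgo : IsOpenMap g}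
    (h : imageHom f hf hfo = imageHom g hg hgo) : f = g :=
  eq_of_image_eq hg fun F => congrArg RegularClosed.carrier (congrFun (congrArg ESkeHom.toFun h) F)

theorem exists_imageHom_eq {X Y : Type u} [TopologicalSpace X] [CompactSpace X] [T2Space X]
    [TopologicalSpace Y] [CompactSpace Y] [T2Space Y]
    (ψ : regularClosedAlgebra X ⟶ regularClosedAlgebra Y) (hψ : condEC7 ψ) :
    ∃ (f : X → Y) (hf : Continuous f) (hfo : IsOpenMap f), imageHom f hf hfo = ψ := by
  obtain ⟨f, hf, hfo, hfψ⟩ := exists_continuous_isOpenMap_image_eq (X := X) (Y := Y)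
    (ESkeHom.toFun ψ) (rightAdj (ESkeHom.toFun ψ)) (gc_rightAdj _ (ESkeHom.map_sSup ψ))
    (ESkeHom.eq_bot_iff ψ) (ESkeHom.map_contact ψ) hψ
  exact ⟨f, hf, hfo, ESkeHom.ext <| funext fun F : RegularClosed X => SetLike.coe_injective (hfψ F)⟩

/-- The functor of regular closed sets, acting on maps by direct image. -/
def regularClosedFunctor : OpC.{u} ⥤ EOpC.{u} where
  obj X := ⟨regularClosedAlgebra X.obj⟩
  map f := ⟨imageHom f.hom f.hom.hom.hom.continuous f.property, condEC7_imageHom _ _ _⟩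
  map_id X := WideSubcategory.hom_ext _ (imageHom_id X.obj)
  map_comp f g := WideSubcategory.hom_ext _
    (imageHom_comp f.hom.hom.hom.continuous f.property g.hom.hom.hom.continuous g.property)

instance : regularClosedFunctor.{u}.Faithful where
  map_injective {X Y f g} h := by
    have h' : imageHom f.hom f.hom.hom.hom.continuous f.property =
        imageHom g.hom g.hom.hom.hom.continuous g.property :=
      congrArg InducedWideCategory.Hom.hom h
    exact WideSubcategory.hom_ext _ (ConcreteCategory.hom_ext _ _ (congrFun (eq_of_imageHom_eq h')))

instance : regularClosedFunctor.{u}.Full where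
  map_surjective {X Y} ψ := by
    obtain ⟨f, hf, hfo, h⟩ := exists_imageHom_eq (X := X.obj) (Y := Y.obj) ψ.hom ψ.property
    let k : X.obj ⟶ Y.obj := ConcreteCategory.ofHom ⟨f, hf⟩
    have hk : openMaps k := hfo
    exact ⟨⟨k, hk⟩, WideSubcategory.hom_ext _ h⟩

/-- An order isomorphism preserving and reflecting contact, as a morphism of `ESkeC`. -/
def homOfOrderIso {A B : ESkeC.{u}} (e : A.carrier ≃o B.carrier)
    (he : ∀ a b, A.C a b → B.C (e a) (e b)) : A ⟶ B :=
  ({ toFun := e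
     eq_bot_iff := fun _ => map_eq_bot_iff e
     map_sSup := fun S => by rw [e.map_sSup, sSup_image]
     exists_preimage := fun a b h => ⟨e.symm b, e.symm_apply_le.mpr h, e.apply_symm_apply b⟩
     map_contact := he } : ESkeHom A B)

theorem condEC7_homOfOrderIso {A B : ESkeC.{u}} (e : A.carrier ≃o B.carrier)
    (he : ∀ a b, A.C a b → B.C (e a) (e b)) (he' : ∀ a b, B.C a b → A.C (e.symm a) (e.symm b)) :
    condEC7 (homOfOrderIso e he) := by
  intro a b h
  rw [show rightAdj (ESkeHom.toFun (homOfOrderIso e he)) = e.symm from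
    rightAdj_eq_of_gc e.to_galoisConnection]
  have := he' _ _ h
  rwa [show (homOfOrderIso e he).toFun a = e a from rfl, e.symm_apply_apply] at this

/-- An order isomorphism preserving and reflecting contact, as an isomorphism of `EOpC`. -/
def isoOfOrderIso {A B : ESkeC.{u}} (e : A.carrier ≃o B.carrier)
    (he : ∀ a b, A.C a b → B.C (e a) (e b)) (he' : ∀ a b, B.C a b → A.C (e.symm a) (e.symm b)) :
    (⟨A⟩ : EOpC.{u}) ≅ ⟨B⟩ :=
  WideSubcategory.isoMk
    { hom := homOfOrderIso e he
      inv := homOfOrderIso e.symm he'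
      hom_inv_id := ESkeHom.ext (funext e.symm_apply_apply)
      inv_hom_id := ESkeHom.ext (funext e.apply_symm_apply) }
    (condEC7_homOfOrderIso e he he') (condEC7_homOfOrderIso e.symm he' he)

open ClusterSpace in
instance : regularClosedFunctor.{u}.EssSurj where
  mem_essImage := by
    rintro ⟨A⟩
    have hC := A.isNormalContact
    have := compactSpace (C := A.C)
    have := t2Space hC
    have he : ∀ a b, A.C a b ↔ Contact (regularLocusIso hC a) (regularLocusIso hC b) :=
      fun a b => contact_iff_nonempty_inter hC
    refine ⟨⟨CompHaus.of (ClusterSpace A.C)⟩, ⟨?_⟩⟩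
    change (⟨regularClosedAlgebra (ClusterSpace A.C)⟩ : EOpC) ≅ ⟨A⟩
    refine (isoOfOrderIso (B := regularClosedAlgebra (ClusterSpace A.C)) (regularLocusIso hC)
      (fun a b => (he a b).mp) fun F G h => (he _ _).mpr ?_).symm
    rw [OrderIso.apply_symm_apply, OrderIso.apply_symm_apply]
    exact h

instance : regularClosedFunctor.{u}.IsEquivalence where

end ContactDuality
theorem theorem4p9 : Nonempty (ContactDuality.OpC.{u} ≌ ContactDuality.EOpC.{u}) :=
  ⟨ContactDuality.regularClosedFunctor.asEquivalence⟩
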